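/- Let $K$ be a field of characteristic $\neq 2,3$ containing a primitive third root of unity $\omega$. Let $a_1,a_2,a_3\in K$ and suppose that the diagonal cubic surface $$S=\{(x_1:x_2:x_3:x_4)\in\mathbb P^3_K \mid a_1(x_1^3-x_4^3)+a_2(x_2^3-x_4^3)+a_3(x_3^3-x_4^3)=0\}$$ is smooth over $K$. Then there is a dominant rational map $\mathbb P^2_K\dashrightarrow S$, defined over $K$, of degree at most $6$; that is, the induced extension of function fields $K(S)\hookrightarrow K(\mathbb P^2_K)$ has degree at most $6$. -/

import Mathlib

open MvPolynomial

/-- The hypersurface `{F = 0}` in `ℙⁿ` over `K`, `F` a form in `n + 1` variables, is smooth over `K`: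
at every geometric point of `{F = 0}` some partial derivative of `F` does not vanish. -/
def IsSmoothHypersurface {K : Type*} [Field K] {n : ℕ}
    (F : MvPolynomial (Fin (n + 1)) K) : Prop :=
  ∀ x : Fin (n + 1) → AlgebraicClosure K, x ≠ 0 → aeval x F = 0 → ∃ i, aeval x (pderiv i F) ≠ 0

/-- The form `a₁ (x₁³ - x₄³) + a₂ (x₂³ - x₄³) + a₃ (x₃³ - x₄³)` (variables indexed from `0`). -/
noncomputable def diagonalCubic {K : Type*} [Field K] (a : Fin 3 → K) :
    MvPolynomial (Fin 4) K :=
  C (a 0) * (X 0 ^ 3 - X 3 ^ 3) + C (a 1) * (X 1 ^ 3 - X 3 ^ 3) + C (a 2) * (X 2 ^ 3 - X 3 ^ 3)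

/-- (A representative of) a rational map `ℙᵐ ⇢ ℙⁿ` over `K`: a tuple of forms
`(f₀ : ⋯ : fₙ)` of one and the same degree in `m + 1` variables over `K`, not all zero. -/
structure ProjRationalMap (K : Type*) [Field K] (m n : ℕ) where
  /-- the coordinate forms -/
  coord : Fin (n + 1) → MvPolynomial (Fin (m + 1)) K
  /-- the common degree of the coordinate forms -/
  formDegree : ℕ
  isHomogeneous : ∀ i, (coord i).IsHomogeneous formDegree
  exists_ne_zero : ∃ i, coord i ≠ 0

namespace ProjRationalMap

variable {K : Type*} [Field K] {m n : ℕ}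

/-- The identity of `ℙᵐ`. -/
noncomputable def id (K : Type*) [Field K] (m : ℕ) : ProjRationalMap K m m where
  coord := X
  formDegree := 1
  isHomogeneous := isHomogeneous_X K
  exists_ne_zero := ⟨0, X_ne_zero 0⟩

/-- `φ` maps into the hypersurface `{F = 0}`: the equation holds identically on `φ`. -/
def MapsInto (φ : ProjRationalMap K m n) (F : MvPolynomial (Fin (n + 1)) K) : Prop :=
  bind₁ φ.coord F = 0

/-- The image of `φ` is Zariski dense in the hypersurface `{F = 0}`: every form over `K` that
vanishes on the image of `φ` vanishes at all geometric points of `{F = 0}`. -/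
def IsDenseIn (φ : ProjRationalMap K m n) (F : MvPolynomial (Fin (n + 1)) K) : Prop :=
  ∀ (G : MvPolynomial (Fin (n + 1)) K) (d : ℕ), G.IsHomogeneous d → bind₁ φ.coord G = 0 →
    ∀ x : Fin (n + 1) → AlgebraicClosure K, aeval x F = 0 → aeval x G = 0

/-- `φ` is a dominant rational map from `ℙᵐ` to the hypersurface `{F = 0} ⊆ ℙⁿ`. -/
def IsDominantOnto (φ : ProjRationalMap K m n) (F : MvPolynomial (Fin (n + 1)) K) : Prop :=
  φ.MapsInto F ∧ φ.IsDenseIn F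

/-- The field of all pullbacks `(G / H) ∘ φ` of rational functions `G / H` (`G`, `H` forms of the
same degree, `H` not vanishing identically on the image of `φ`). When `φ` is dominant onto an
integral `S`, this is the image `φ^* K(S)` of the function field of `S`. -/
noncomputable def pullbackField (φ : ProjRationalMap K m n) :
    IntermediateField K (FractionRing (MvPolynomial (Fin (m + 1)) K)) where
  carrier := {r | ∃ (d : ℕ) (G H : MvPolynomial (Fin (n + 1)) K),
    G.IsHomogeneous d ∧ H.IsHomogeneous d ∧ bind₁ φ.coord H ≠ 0 ∧
    r = algebraMap _ _ (bind₁ φ.coord G) / algebraMap _ _ (bind₁ φ.coord H)}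
  mul_mem' := by
    rintro _ _ ⟨d, G, H, hG, hH, h0, rfl⟩ ⟨d', G', H', hG', hH', h0', rfl⟩
    refine ⟨d + d', G * G', H * H', hG.mul hG', hH.mul hH', ?_, ?_⟩
    · rw [map_mul]; exact mul_ne_zero h0 h0'
    · simp only [map_mul]; rw [div_mul_div_comm]
  add_mem' := by
    rintro _ _ ⟨d, G, H, hG, hH, h0, rfl⟩ ⟨d', G', H', hG', hH', h0', rfl⟩
    refine ⟨d + d', G * H' + H * G', H * H', (hG.mul hH').add (hH.mul hG'), hH.mul hH', ?_, ?_⟩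
    · rw [map_mul]; exact mul_ne_zero h0 h0'
    · simp only [map_mul, map_add]
      rw [div_add_div _ _ (by simpa using h0) (by simpa using h0')]
  algebraMap_mem' := by
    intro c
    refine ⟨0, C c, 1, isHomogeneous_C _ c, isHomogeneous_one _ _, by simp, ?_⟩
    simp only [map_one, div_one, bind₁_C_right]
    rw [IsScalarTower.algebraMap_apply K (MvPolynomial (Fin (m + 1)) K), algebraMap_eq]
  inv_mem' := by
    rintro _ ⟨d, G, H, hG, hH, h0, rfl⟩
    by_cases h : bind₁ φ.coord G = 0
    · exact ⟨d, G, H, hG, hH, h0, by simp [h]⟩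
    · exact ⟨d, H, G, hH, hG, h, by rw [inv_div]⟩

/-- The function field `K(ℙᵐ)`: all quotients of forms of the same degree in `m + 1` variables. -/
noncomputable def functionField (K : Type*) [Field K] (m : ℕ) :
    IntermediateField K (FractionRing (MvPolynomial (Fin (m + 1)) K)) :=
  (ProjRationalMap.id K m).pullbackField

theorem bind₁_isHomogeneous (φ : ProjRationalMap K m n) {G : MvPolynomial (Fin (n + 1)) K} {d : ℕ}
    (hG : G.IsHomogeneous d) : (bind₁ φ.coord G).IsHomogeneous (φ.formDegree * d) :=
  hG.aeval φ.coord φ.isHomogeneous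

theorem pullbackField_le (φ : ProjRationalMap K m n) :
    φ.pullbackField ≤ functionField K m := by
  rintro _ ⟨d, G, H, hG, hH, h0, rfl⟩
  have key : ∀ P : MvPolynomial (Fin (m + 1)) K, bind₁ (ProjRationalMap.id K m).coord P = P :=
    fun P => by simp [ProjRationalMap.id]
  exact ⟨φ.formDegree * d, bind₁ φ.coord G, bind₁ φ.coord H, φ.bind₁_isHomogeneous hG,
    φ.bind₁_isHomogeneous hH, by rwa [key], by rw [key, key]⟩

/-- The degree `[K(ℙᵐ) : φ^* K(S)]` of a rational map `φ` that is dominant onto `S`, as a cardinal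
(so that it is not `0` when the extension is infinite). -/
noncomputable def degree (φ : ProjRationalMap K m n) : Cardinal :=
  Module.rank φ.pullbackField (IntermediateField.extendScalars φ.pullbackField_le)

end ProjRationalMap

/-!
Write the surface as `∑ aᵢ xᵢ³ = 0` with four coefficients, where `∑ aᵢ = 0`; smoothness means that
no `aᵢ` vanishes. It contains the point `P = (1 : 1 : 1 : 1)`. A tangent line of the surface at a
point meets the surface in one further point. Following the tangent lines at `P`, with parameter
`u`, gives a rational curve `q(u)` on the surface (`nodalCurve`); following the tangent lines at
`q(u)`, with parameter `t`, gives a rational map `(u, t) ↦ s` from the plane to the surface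
(`tangentSurface`). Since the substitution `xᵢ = qᵢ zᵢ` moves `q` to `P` and turns the coefficients
into `aᵢ qᵢ³`, a single construction (`tangentResidual`) serves for both steps.

The degree is at most six. As `s` lies in the tangent plane at `q(u)`, the parameter `u` satisfies
`∑ aᵢ qᵢ(u)² sᵢ = 0`, and the `qᵢ` are cubic polynomials in `u`. Once `u` and `s` are known, `t` is
the direction of the line from `q(u)` to `s` (`tangentSurface_param`). Hence the function field of
the plane is generated by `u` over that of the surface.

The equation for `u` is not trivial because `s` does not move in a plane
(`tangentSurface_linearIndependent`). For if `∑ cᵢ sᵢ = 0` for all `t`, then either this plane is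
the tangent plane at `q(u)`, or the tangent section at `q(u)` consists of three lines
(`tangentResidual_relation`). In both cases all ratios `qᵢ / qⱼ` are algebraic over `K`, whereas
`u` is a rational function of them. This uses that the tangent section at a point without vanishing
coordinates has a node there, and covers the cases in which lines pass through `P` as well.

The map is dominant. The field generated by three of the four forms representing `s` has an
algebraic extension that contains the fourth form, then `u`, then `t`, and finally all three
coordinates of the plane, so these three forms are algebraically independent
(`algebraicIndependent_tangentSurfaceForm`). Over the field of rational functions in three of the
coordinates, the equation of the surface is an irreducible cubic in the fourth, so it divides every
form that vanishes on the image (`diagonal_dvd_of_aeval_eq_zero`).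
-/

/-! ### The residual point of a tangent line -/

section TangentLine

variable {R S : Type*} [CommRing R] [CommRing S]

/-- The direction `(A₂x, A₂y, -(A₀x + A₁y), 0)` with parameter `(x : y)` in the tangent plane
`∑ Aᵢ eᵢ = 0` of the cubic surface `∑ Aᵢ xᵢ³ = 0` at `(1 : 1 : 1 : 1)`. -/
def tangentDirection (A : Fin 4 → R) (x y : R) : Fin 4 → R :=
  ![A 2 * x, A 2 * y, -(A 0 * x + A 1 * y), 0]

/-- The third intersection point of the cubic surface `∑ Aᵢ xᵢ³ = 0`, where `∑ Aᵢ = 0`, with its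
tangent line at `(1 : 1 : 1 : 1)` in the direction `e = tangentDirection A x y`. As
`∑ Aᵢ (λ + eᵢ)³ = 3 λ ∑ Aᵢ eᵢ² + ∑ Aᵢ eᵢ³`, it is
`(∑ Aⱼ eⱼ³) (1, 1, 1, 1) - 3 (∑ Aⱼ eⱼ²) e`. -/
def tangentResidual (A : Fin 4 → R) (x y : R) (i : Fin 4) : R :=
  (∑ j, A j * tangentDirection A x y j ^ 3) -
    3 * (∑ j, A j * tangentDirection A x y j ^ 2) * tangentDirection A x y i

theorem map_tangentDirection (f : R →+* S) (A : Fin 4 → R) (x y : R) (i : Fin 4) :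
    f (tangentDirection A x y i) = tangentDirection (fun j => f (A j)) (f x) (f y) i := by
  fin_cases i <;> simp [tangentDirection]

theorem map_tangentResidual (f : R →+* S) (A : Fin 4 → R) (x y : R) (i : Fin 4) :
    f (tangentResidual A x y i) = tangentResidual (fun j => f (A j)) (f x) (f y) i := by
  simp [tangentResidual, map_tangentDirection, map_ofNat]

/-- The direction from `(1 : 1 : 1 : 1)` to the residual point determines `(x : y)`. -/
theorem tangentResidual_sub_three_mul (A : Fin 4 → R) (x y : R) :
    (tangentResidual A x y 1 - tangentResidual A x y 3) * x =
      (tangentResidual A x y 0 - tangentResidual A x y 3) * y := by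
  simp [tangentResidual, tangentDirection]; ring

theorem sum_mul_tangentResidual {A : Fin 4 → R} (hA : ∑ i, A i = 0) (x y : R) :
    ∑ i, A i * tangentResidual A x y i = 0 := by
  simp only [Fin.sum_univ_four] at hA
  simp [tangentResidual, tangentDirection, Fin.sum_univ_four]
  linear_combination (A 0 * (A 2 * x) ^ 3 + A 1 * (A 2 * y) ^ 3 +
    A 2 * (-(A 1 * y) + -(A 0 * x)) ^ 3) * hA

theorem sum_mul_tangentResidual_cube {A : Fin 4 → R} (hA : ∑ i, A i = 0) (x y : R) :
    ∑ i, A i * tangentResidual A x y i ^ 3 = 0 := by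
  have he : ∑ i, A i * tangentDirection A x y i = 0 := by
    simp [tangentDirection, Fin.sum_univ_four]; ring
  simp only [tangentResidual]
  generalize tangentDirection A x y = e at he ⊢
  simp only [Fin.sum_univ_four] at *
  generalize hF : A 0 * e 0 ^ 3 + A 1 * e 1 ^ 3 + A 2 * e 2 ^ 3 + A 3 * e 3 ^ 3 = F
  generalize hQ : A 0 * e 0 ^ 2 + A 1 * e 1 ^ 2 + A 2 * e 2 ^ 2 + A 3 * e 3 ^ 2 = Q
  linear_combination F ^ 3 * hA - 9 * F ^ 2 * Q * he + 27 * F * Q ^ 2 * hQ - 27 * Q ^ 3 * hF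

end TangentLine

/-! ### Linear relations satisfied by the residual point -/

section Generic

variable {R E : Type*} [CommRing R] [CommRing E] [Algebra R E]

theorem Transcendental.cubic_coeff_eq_zero {t : E} (ht : Transcendental R t) {c₀ c₁ c₂ c₃ : R}
    (h : algebraMap R E c₀ + algebraMap R E c₁ * t + algebraMap R E c₂ * t ^ 2 +
      algebraMap R E c₃ * t ^ 3 = 0) : c₀ = 0 ∧ c₁ = 0 ∧ c₂ = 0 ∧ c₃ = 0 := by
  have h0 := (transcendental_iff.mp ht) (Polynomial.C c₀ + Polynomial.C c₁ * Polynomial.X +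
    Polynomial.C c₂ * Polynomial.X ^ 2 + Polynomial.C c₃ * Polynomial.X ^ 3) (by simpa using h)
  have hc : ∀ n, _ := fun n => congrArg (fun p => Polynomial.coeff p n) h0
  exact ⟨by simpa [Polynomial.coeff_X, Polynomial.coeff_X_pow, Polynomial.coeff_C] using hc 0,
    by simpa [Polynomial.coeff_X, Polynomial.coeff_X_pow, Polynomial.coeff_C] using hc 1,
    by simpa [Polynomial.coeff_X, Polynomial.coeff_X_pow, Polynomial.coeff_C] using hc 2,
    by simpa [Polynomial.coeff_X, Polynomial.coeff_X_pow, Polynomial.coeff_C] using hc 3⟩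

variable [IsDomain R] {A : Fin 4 → R} {t : E}

/-- The coefficients of `(∑ wᵢ zᵢ) / A₂`, a cubic polynomial in `t`, where `z` is the residual
point with parameter `(1 : t)`. -/
theorem tangentResidual_relation_coeff (h3 : (3 : R) ≠ 0) (hA2 : A 2 ≠ 0)
    (ht : Transcendental R t) {w : Fin 4 → R}
    (h : ∑ i, algebraMap R E (w i) * tangentResidual (fun j => algebraMap R E (A j)) 1 t i = 0) :
    A 0 * (A 0 + A 2) * ((∑ i, w i) * (A 2 - A 0) - 3 * (w 0 * A 2 - w 2 * A 0)) = 0 ∧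
    A 0 * ((∑ i, w i) * A 0 * A 1 + 2 * A 1 * (w 0 * A 2 - w 2 * A 0) +
      (A 0 + A 2) * (w 1 * A 2 - w 2 * A 1)) = 0 ∧
    A 1 * ((∑ i, w i) * A 0 * A 1 + 2 * A 0 * (w 1 * A 2 - w 2 * A 1) +
      (A 1 + A 2) * (w 0 * A 2 - w 2 * A 0)) = 0 ∧
    A 1 * (A 1 + A 2) * ((∑ i, w i) * (A 2 - A 1) - 3 * (w 1 * A 2 - w 2 * A 1)) = 0 := by
  have key := ht.cubic_coeff_eq_zero
    (c₀ := A 2 * (A 0 * (A 0 + A 2) * ((∑ i, w i) * (A 2 - A 0) - 3 * (w 0 * A 2 - w 2 * A 0))))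
    (c₁ := -(3 * A 2 * (A 0 * ((∑ i, w i) * A 0 * A 1 + 2 * A 1 * (w 0 * A 2 - w 2 * A 0) +
      (A 0 + A 2) * (w 1 * A 2 - w 2 * A 1)))))
    (c₂ := -(3 * A 2 * (A 1 * ((∑ i, w i) * A 0 * A 1 + 2 * A 0 * (w 1 * A 2 - w 2 * A 1) +
      (A 1 + A 2) * (w 0 * A 2 - w 2 * A 0)))))
    (c₃ := A 2 * (A 1 * (A 1 + A 2) *
      ((∑ i, w i) * (A 2 - A 1) - 3 * (w 1 * A 2 - w 2 * A 1)))) (by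
      rw [← h]
      simp only [tangentResidual, tangentDirection, Fin.sum_univ_four, map_add, map_sub, map_mul,
        map_neg, map_ofNat, Matrix.cons_val]
      ring)
  simpa only [neg_eq_zero, mul_eq_zero, hA2, h3, false_or] using key

/-- Each coordinate of the residual point is a nonzero cubic polynomial in `t`: its coefficients
cannot all vanish, as otherwise some `Aᵢ` would. -/
theorem tangentResidual_ne_zero (h2 : (2 : R) ≠ 0) (h3 : (3 : R) ≠ 0) (hA : ∑ i, A i = 0)
    (hA0 : ∀ i, A i ≠ 0) (ht : Transcendental R t) (i : Fin 4) :
    tangentResidual (fun j => algebraMap R E (A j)) 1 t i ≠ 0 := by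
  intro hi
  obtain ⟨k0, k1, k2, k3⟩ := tangentResidual_relation_coeff h3 (hA0 2) ht
    (w := Pi.single i 1) (by rw [Finset.sum_eq_single i] <;> simp +contextual [hi])
  have n0 := hA0 0
  have n1 := hA0 1
  have n2 := hA0 2
  have n3 := hA0 3
  rw [Fin.sum_univ_four] at hA
  simp only [mul_eq_zero, n0, n1, false_or] at k0 k1 k2 k3
  fin_cases i <;> simp [Pi.single_apply] at k0 k1 k2 k3
  · rcases k3 with h | h
    · have h' : A 0 * A 1 = 0 := by linear_combination k2 - A 2 * h
      simp_all
    · have h' : A 1 * A 3 = 0 := by linear_combination A 1 * hA - k2 + (2 * A 1 + A 2) * h - A 1 * h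
      simp_all
  · rcases k0 with h | h
    · have h' : A 0 * A 1 = 0 := by linear_combination k1 - A 2 * h
      simp_all
    · have h' : A 0 * A 3 = 0 := by linear_combination A 0 * hA - k1 + (2 * A 0 + A 2) * h - A 0 * h
      simp_all
  · have e1 : A 1 * (2 * A 0 + A 2) = 0 := by linear_combination -k1
    have e2 : A 0 * (2 * A 1 + A 2) = 0 := by linear_combination -k2
    simp only [mul_eq_zero, n0, n1, false_or] at e1 e2
    have h' : 2 * A 3 = 0 := by linear_combination 2 * hA - e1 - e2
    simp_all
  · simp_all

/-- The residual point differs from `(1 : 1 : 1 : 1)`, as `∑ Aᵢ eᵢ²` does not vanish identically on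
the tangent plane. -/
theorem tangentResidual_zero_ne_three (h2 : (2 : R) ≠ 0) (h3 : (3 : R) ≠ 0)
    (hA0 : ∀ i, A i ≠ 0) (ht : Transcendental R t) :
    tangentResidual (fun j => algebraMap R E (A j)) 1 t 0 ≠
      tangentResidual (fun j => algebraMap R E (A j)) 1 t 3 := by
  intro h
  obtain ⟨-, h', -⟩ := tangentResidual_relation_coeff h3 (hA0 2) ht (w := ![1, 0, 0, -1])
    (by simp [Fin.sum_univ_four, h])
  simp [Fin.sum_univ_four, hA0, h2] at h'

/-- A linear relation `∑ wᵢ zᵢ = 0` satisfied by the residual point `z` for all tangent directions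
is a multiple of `∑ Aᵢ zᵢ = 0`, unless the cubic form `∑ Aᵢ eᵢ³` is divisible by the quadratic
form `∑ Aᵢ eᵢ²` on the tangent plane, which forces `Aᵢ = ± Aⱼ` for all `i`, `j`. -/
theorem tangentResidual_relation (h2 : (2 : R) ≠ 0) (h3 : (3 : R) ≠ 0) (hA : ∑ i, A i = 0)
    (hA0 : ∀ i, A i ≠ 0) (ht : Transcendental R t) {w : Fin 4 → R}
    (h : ∑ i, algebraMap R E (w i) * tangentResidual (fun j => algebraMap R E (A j)) 1 t i = 0) :
    (∀ i j, w i * A j = w j * A i) ∨ ∀ i j, A i ^ 2 = A j ^ 2 := by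
  obtain ⟨k0, k1, k2, k3⟩ := tangentResidual_relation_coeff h3 (hA0 2) ht h
  have n0 := hA0 0
  have n1 := hA0 1
  have n2 := hA0 2
  have n3 := hA0 3
  rw [Fin.sum_univ_four] at hA
  obtain ⟨W, hW⟩ : ∃ W, W = ∑ i, w i := ⟨_, rfl⟩
  obtain ⟨m, hm⟩ : ∃ m, m = w 0 * A 2 - w 2 * A 0 := ⟨_, rfl⟩
  obtain ⟨n, hn⟩ : ∃ n, n = w 1 * A 2 - w 2 * A 1 := ⟨_, rfl⟩
  simp only [← hW, ← hm, ← hn, mul_eq_zero, n0, n1, false_or] at k0 k1 k2 k3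
  rw [Fin.sum_univ_four] at hW
  -- `W = 0` means that the plane `∑ wᵢ xᵢ = 0` passes through `(1 : 1 : 1 : 1)`; the coefficients
  -- `m`, `n` of the relation on the tangent plane then vanish since `∑ Aᵢ eᵢ²` is nondegenerate
  by_cases hW0 : W = 0
  · left
    have hm0 : m = 0 := by
      by_contra hm0
      rcases k0 with h | h
      · have h' : 2 * A 1 * m = 0 := by linear_combination k1 - A 0 * A 1 * hW0 - n * h
        simp [h2, n1, hm0] at h'
      · have h' : 3 * m = 0 := by linear_combination (A 2 - A 0) * hW0 - h
        simp [h3, hm0] at h'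
    have hn0 : n = 0 := by
      by_contra hn0
      rcases k3 with h | h
      · have h' : 2 * A 0 * n = 0 := by linear_combination k2 - A 0 * A 1 * hW0 - m * h
        simp [h2, n0, hn0] at h'
      · have h' : 3 * n = 0 := by linear_combination (A 2 - A 1) * hW0 - h
        simp [h3, hn0] at h'
    have key : ∀ i, w i * A 2 = w 2 * A i := by
      intro i
      fin_cases i
      · show w 0 * A 2 = w 2 * A 0
        linear_combination hm0 - hm
      · show w 1 * A 2 = w 2 * A 1
        linear_combination hn0 - hn
      · rfl
      · show w 3 * A 2 = w 2 * A 3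
        linear_combination A 2 * hW0 - A 2 * hW - w 2 * hA + hm - hm0 + hn - hn0
    intro i j
    refine mul_right_cancel₀ n2 ?_
    linear_combination A j * key i - A i * key j
  · right
    have key : A 0 ^ 2 = A 2 ^ 2 ∧ A 1 ^ 2 = A 2 ^ 2 ∧ A 3 ^ 2 = A 2 ^ 2 := by
      by_cases h0 : A 0 + A 2 = 0
      · have e1 : A 1 * (W * A 0 + 2 * m) = 0 := by linear_combination k1 - n * h0
        simp only [mul_eq_zero, n1, false_or] at e1
        have h1 : A 1 ^ 2 = A 2 ^ 2 := by
          rcases k3 with h | h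
          · linear_combination (A 1 - A 2) * h
          · have e2 : W * A 0 * (A 2 - A 1) = 0 := by
              linear_combination 6 * k2 + 4 * A 0 * h - 3 * (A 1 + A 2) * e1
            simp only [mul_eq_zero, n0, hW0, false_or] at e2
            linear_combination -(A 1 + A 2) * e2
        refine ⟨by linear_combination (A 0 - A 2) * h0, h1, ?_⟩
        linear_combination h1 + (A 3 - A 1) * (hA - h0)
      · by_cases h1 : A 1 + A 2 = 0
        · have e1 : A 0 * (W * A 1 + 2 * n) = 0 := by linear_combination k2 - m * h1
          simp only [mul_eq_zero, n0, h0, false_or] at e1 k0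
          have e2 : W * A 1 * (A 2 - A 0) = 0 := by
            linear_combination 6 * k1 + 4 * A 1 * k0 - 3 * (A 0 + A 2) * e1
          simp only [mul_eq_zero, n1, hW0, false_or] at e2
          have h2 : A 0 ^ 2 = A 2 ^ 2 := by linear_combination -(A 0 + A 2) * e2
          refine ⟨h2, by linear_combination (A 1 - A 2) * h1, ?_⟩
          linear_combination h2 + (A 3 - A 0) * (hA - h1)
        · simp only [h0, h1, false_or] at k0 k3
          have h' : W * A 2 * A 3 = 0 := by
            linear_combination W * A 2 * hA - 3 * k1 - 2 * A 1 * k0 - (A 0 + A 2) * k3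
          simp_all
    have all : ∀ i, A i ^ 2 = A 2 ^ 2 := by
      intro i
      fin_cases i
      · exact key.1
      · exact key.2.1
      · rfl
      · exact key.2.2
    exact fun i j => (all i).trans (all j).symm

end Generic

/-! ### Forms vanishing on a dense part of a diagonal cubic surface -/

section Cubic

/-- The diagonal binary cubic `α x³ + β` is not the cube of a polynomial: a cube root would divide
both `α x³ + β` and its derivative. -/
theorem Polynomial.cube_ne_C_mul_X_cube_add_C {K : Type*} [Field K] (h3 : (3 : K) ≠ 0) {α β : K}
    (hα : α ≠ 0) (hβ : β ≠ 0) (h : Polynomial K) :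
    h ^ 3 ≠ Polynomial.C α * Polynomial.X ^ 3 + Polynomial.C β := by
  intro e
  have h1 : h ^ 2 * Polynomial.derivative h = Polynomial.C α * Polynomial.X ^ 2 := by
    have d := congrArg Polynomial.derivative e
    simp only [Polynomial.derivative_pow, Polynomial.derivative_add, Polynomial.derivative_C_mul,
      Polynomial.derivative_X, Polynomial.derivative_C] at d
    have h3' : (Polynomial.C (3 : K)) ≠ 0 := by simpa using h3
    refine mul_left_cancel₀ h3' ?_
    simp only [Nat.cast_ofNat, Nat.add_one_sub_one, add_zero] at d
    linear_combination d
  -- `h³ - x (h² h') = β`, so that `h` divides a nonzero constant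
  have hu : IsUnit h := by
    refine isUnit_of_dvd_unit (y := Polynomial.C β)
      ⟨h ^ 2 - Polynomial.X * (h * Polynomial.derivative h), ?_⟩
      (Polynomial.isUnit_C.mpr hβ.isUnit)
    linear_combination Polynomial.X * h1 - e
  have hd := Polynomial.natDegree_eq_zero_of_isUnit (hu.pow 3)
  rw [e, Polynomial.natDegree_add_C, Polynomial.natDegree_C_mul_X_pow 3 α hα] at hd
  omega

theorem MvPolynomial.cube_ne_diagonal {K : Type*} [Field K] (h3 : (3 : K) ≠ 0) {b : Fin 3 → K}
    (hb : ∀ i, b i ≠ 0) (h : MvPolynomial (Fin 3) K) : h ^ 3 ≠ ∑ i, C (b i) * X i ^ 3 := by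
  intro e
  let f : MvPolynomial (Fin 3) K →ₐ[K] Polynomial K := aeval ![Polynomial.X, 1, 0]
  have e' : f (h ^ 3) = f (∑ i, C (b i) * X i ^ 3) := congrArg f e
  refine Polynomial.cube_ne_C_mul_X_cube_add_C h3 (hb 0) (hb 1) (f h) ?_
  simpa [f, Fin.sum_univ_three, Polynomial.algebraMap_eq] using e'

/-- A monic polynomial that is irreducible over the fraction field divides every polynomial with
which it shares a root in an extension field. -/
theorem Polynomial.dvd_of_eval₂_eq_zero_of_irreducible_map {A L E : Type*} [CommRing A] [IsDomain A]
    [Field L] [Algebra A L] [IsFractionRing A L] [Field E] {ι : A →+* E}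
    (hι : Function.Injective ι) {P : Polynomial A} (hPm : P.Monic)
    (hirr : Irreducible (P.map (algebraMap A L))) {s : E} (hP : P.eval₂ ι s = 0)
    {g : Polynomial A} (hg : g.eval₂ ι s = 0) : P ∣ g := by
  rw [← Polynomial.modByMonic_eq_zero_iff_dvd hPm]
  by_contra hr
  have hL := IsFractionRing.injective A L
  have hndvd : ¬ P.map (algebraMap A L) ∣ (g %ₘ P).map (algebraMap A L) := by
    refine Polynomial.not_dvd_of_degree_lt ((Polynomial.map_ne_zero_iff hL).mpr hr) ?_
    rw [Polynomial.degree_map_eq_of_injective hL, Polynomial.degree_map_eq_of_injective hL]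
    exact Polynomial.degree_modByMonic_lt _ hPm
  obtain ⟨u, v, huv⟩ := hirr.coprime_iff_not_dvd.mpr hndvd
  obtain ⟨φ, hφ⟩ : ∃ φ : L →+* E, φ.comp (algebraMap A L) = ι :=
    ⟨IsFractionRing.lift hι, RingHom.ext fun x => IsFractionRing.lift_algebraMap hι x⟩
  have hrs : (g %ₘ P).eval₂ ι s = 0 := by
    rw [Polynomial.modByMonic_eq_sub_mul_div, Polynomial.eval₂_sub, Polynomial.eval₂_mul, hP, hg,
      zero_mul, sub_zero]
  have := congrArg (Polynomial.eval₂ φ s) huv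
  simp [Polynomial.eval₂_map, hφ, hP, hrs] at this

/-- The form `∑ aᵢ xᵢ³` in four variables generates the ideal of all polynomials vanishing at a
point of its zero set with three algebraically independent coordinates: over the function field of
these coordinates it is an irreducible cubic in the remaining variable. -/
theorem diagonal_dvd_of_aeval_eq_zero {K E : Type*} [Field K] [Field E] [Algebra K E]
    (h3 : (3 : K) ≠ 0) {a : Fin 4 → K} (ha : ∀ i, a i ≠ 0) {s : Fin 4 → E}
    (hs : AlgebraicIndependent K fun i : Fin 3 => s i.succ) (hF : ∑ i, a i • s i ^ 3 = 0)
    {G : MvPolynomial (Fin 4) K} (hG : aeval s G = 0) :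
    (∑ i, C (a i) * X i ^ 3) ∣ G := by
  -- `c = -∑ (aᵢ₊₁ / a₀) xᵢ³`, the value of `x₀³` on the surface
  set c : MvPolynomial (Fin 3) K := ∑ i, C (-a i.succ / a 0) * X i ^ 3 with hc
  set P : Polynomial (MvPolynomial (Fin 3) K) := Polynomial.X ^ 3 - Polynomial.C c with hP
  have hPm : P.Monic := Polynomial.monic_X_pow_sub_C c (by norm_num)
  have hFP : finSuccEquiv K 3 (∑ i, C (a i) * X i ^ 3) = Polynomial.C (C (a 0)) * P := by
    have hC : ∀ r, finSuccEquiv K 3 (C r) = Polynomial.C (C r) := fun r =>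
      (finSuccEquiv K 3).commutes r
    have h0 : C (a 0) * c = -∑ i : Fin 3, C (a i.succ) * X i ^ 3 := by
      rw [hc, Finset.mul_sum, ← Finset.sum_neg_distrib]
      refine Finset.sum_congr rfl fun i _ => ?_
      rw [← mul_assoc, ← C_mul, mul_div_cancel₀ _ (ha 0), C_neg, neg_mul]
    rw [hP, mul_sub, ← Polynomial.C_mul, h0, Fin.sum_univ_succ]
    simp [hC, finSuccEquiv_X_zero, finSuccEquiv_X_succ]
  set g := finSuccEquiv K 3 G with hg
  suffices hPg : P ∣ g by
    obtain ⟨q, hq⟩ := hPg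
    refine ⟨C (a 0)⁻¹ * (finSuccEquiv K 3).symm q, ?_⟩
    apply (finSuccEquiv K 3).injective
    have hC : finSuccEquiv K 3 (C (a 0)⁻¹) = Polynomial.C (C (a 0)⁻¹) :=
      (finSuccEquiv K 3).commutes _
    have h1 : Polynomial.C (C (a 0)) * Polynomial.C (C (a 0)⁻¹) =
        (1 : Polynomial (MvPolynomial (Fin 3) K)) := by
      rw [← Polynomial.C_mul, ← C_mul, mul_inv_cancel₀ (ha 0), C_1, Polynomial.C_1]
    rw [← hg, hq, map_mul, hFP, map_mul, AlgEquiv.apply_symm_apply, hC]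
    linear_combination -(P * q) * h1
  let ι : MvPolynomial (Fin 3) K →+* E := (aeval fun i : Fin 3 => s i.succ : _ →ₐ[K] E).toRingHom
  have hι : Function.Injective ι := hs
  have hev : ∀ H : MvPolynomial (Fin 4) K, (finSuccEquiv K 3 H).eval₂ ι (s 0) = aeval s H := by
    intro H
    induction H using MvPolynomial.induction_on with
    | C r =>
      rw [show finSuccEquiv K 3 (C r) = Polynomial.C (C r) from (finSuccEquiv K 3).commutes r]
      simp [ι]
    | add p q hp hq => rw [map_add, Polynomial.eval₂_add, hp, hq, map_add]
    | mul_X p i hp =>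
      rw [map_mul, Polynomial.eval₂_mul, hp, map_mul, aeval_X]
      congr 1
      refine Fin.cases ?_ (fun j => ?_) i
      · simp [finSuccEquiv_X_zero]
      · simp [finSuccEquiv_X_succ, ι]
  have hgs : g.eval₂ ι (s 0) = 0 := by rw [hg, hev, hG]
  have hPs : P.eval₂ ι (s 0) = 0 := by
    have h1 : (Polynomial.C (C (a 0)) * P).eval₂ ι (s 0) = 0 := by
      rw [← hFP, hev, ← hF, map_sum]
      simp [Algebra.smul_def]
    have h2 : ι (C (a 0)) ≠ 0 := by simp [ι, ha]
    rw [Polynomial.eval₂_mul, Polynomial.eval₂_C] at h1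
    exact (mul_eq_zero.mp h1).resolve_left h2
  let L := FractionRing (MvPolynomial (Fin 3) K)
  have hirr : Irreducible (P.map (algebraMap _ L)) := by
    rw [hP, Polynomial.map_sub, Polynomial.map_pow, Polynomial.map_X, Polynomial.map_C]
    refine X_pow_sub_C_irreducible_of_prime Nat.prime_three fun b hb => ?_
    obtain ⟨h, rfl⟩ := IsIntegrallyClosed.exists_algebraMap_eq_of_isIntegral_pow
      (R := MvPolynomial (Fin 3) K) (x := b) (n := 3) (by norm_num) (hb ▸ isIntegral_algebraMap)
    rw [← map_pow] at hb
    exact MvPolynomial.cube_ne_diagonal h3 (fun i => div_ne_zero (neg_ne_zero.mpr (ha _)) (ha 0)) h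
      (IsFractionRing.injective (MvPolynomial (Fin 3) K) L hb)
  exact Polynomial.dvd_of_eval₂_eq_zero_of_irreducible_map hι hPm hirr hPs hgs

end Cubic

/-! ### The affine parametrization of the surface -/

section Parametrization

variable {K E : Type*} [Field K] [Field E] [Algebra K E]

/-- The affine form of the tangent section of the surface `∑ aᵢ xᵢ³ = 0` at `(1 : 1 : 1 : 1)`:
a rational curve on the surface, with parameter `u`. -/
def nodalCurve (a : Fin 4 → K) (u : E) : Fin 4 → E :=
  tangentResidual (fun j => algebraMap K E (a j)) 1 u

/-- The residual point `s` of the tangent line of `∑ aᵢ xᵢ³ = 0` at `q = nodalCurve a u` in the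
direction with parameter `t`. Substituting `xᵢ = qᵢ zᵢ` turns `q` into `(1 : 1 : 1 : 1)` and the
coefficients into `aᵢ qᵢ³`. -/
def tangentSurface (a : Fin 4 → K) (u t : E) (i : Fin 4) : E :=
  nodalCurve a u i * tangentResidual (fun j => algebraMap K E (a j) * nodalCurve a u j ^ 3) 1 t i

variable {a : Fin 4 → K} (u t : E)

theorem sum_mul_nodalCurve_cube (hsum : ∑ i, a i = 0) :
    ∑ i, algebraMap K E (a i) * nodalCurve a u i ^ 3 = 0 :=
  sum_mul_tangentResidual_cube (by rw [← map_sum, hsum, map_zero]) 1 u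

theorem sum_mul_tangentSurface_cube (hsum : ∑ i, a i = 0) :
    ∑ i, a i • tangentSurface a u t i ^ 3 = 0 := by
  rw [← sum_mul_tangentResidual_cube (sum_mul_nodalCurve_cube u hsum) 1 t]
  refine Finset.sum_congr rfl fun i _ => ?_
  rw [tangentSurface, Algebra.smul_def]; ring

/-- The point `s` lies in the tangent plane at `q`: this is the equation, of degree six in `u`,
that determines `u` from `s`. -/
theorem sum_mul_nodalCurve_sq_mul_tangentSurface (hsum : ∑ i, a i = 0) :
    ∑ i, algebraMap K E (a i) * nodalCurve a u i ^ 2 * tangentSurface a u t i = 0 := by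
  rw [← sum_mul_tangentResidual (sum_mul_nodalCurve_cube u hsum) 1 t]
  refine Finset.sum_congr rfl fun i _ => ?_
  rw [tangentSurface]; ring

variable {u t}

theorem nodalCurve_ne_zero (h2 : (2 : K) ≠ 0) (h3 : (3 : K) ≠ 0) (hsum : ∑ i, a i = 0)
    (ha : ∀ i, a i ≠ 0) (hu : Transcendental K u) (i : Fin 4) : nodalCurve a u i ≠ 0 :=
  tangentResidual_ne_zero h2 h3 hsum ha hu i

/-- The point `q` is not constant: some ratio `qᵢ / q₃` is transcendental, as they determine `u`. -/
theorem not_forall_isAlgebraic_nodalCurve_div (h2 : (2 : K) ≠ 0) (h3 : (3 : K) ≠ 0)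
    (hsum : ∑ i, a i = 0) (ha : ∀ i, a i ≠ 0) (hu : Transcendental K u) :
    ¬ ∀ i, IsAlgebraic K (nodalCurve a u i / nodalCurve a u 3) := by
  intro h
  have hq3 := nodalCurve_ne_zero h2 h3 hsum ha hu 3
  have h03 : nodalCurve a u 0 ≠ nodalCurve a u 3 := tangentResidual_zero_ne_three h2 h3 ha hu
  have hsub := tangentResidual_sub_three_mul (fun j => algebraMap K E (a j)) 1 u
  change (nodalCurve a u 1 - nodalCurve a u 3) * 1 =
    (nodalCurve a u 0 - nodalCurve a u 3) * u at hsub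
  have hue : u = (nodalCurve a u 1 / nodalCurve a u 3 - 1) /
      (nodalCurve a u 0 / nodalCurve a u 3 - 1) := by
    rw [div_sub_one hq3, div_sub_one hq3, div_div_div_cancel_right₀ hq3,
      eq_div_iff (sub_ne_zero.mpr h03)]
    linear_combination -hsub
  refine hu (mem_algebraicClosure_iff.mp ?_)
  rw [hue]
  have hmem : ∀ i, nodalCurve a u i / nodalCurve a u 3 ∈ algebraicClosure K E := fun i =>
    mem_algebraicClosure_iff.mpr (h i)
  exact div_mem (sub_mem (hmem 1) (one_mem _)) (sub_mem (hmem 0) (one_mem _))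

theorem Algebra.ofNat_ne_zero (K R : Type*) [Field K] [CommRing R] [Nontrivial R] [Algebra K R]
    {n : ℕ} [n.AtLeastTwo] (h : (OfNat.ofNat n : K) ≠ 0) : (OfNat.ofNat n : R) ≠ 0 := by
  rw [← map_ofNat (algebraMap K R) n]
  exact (map_ne_zero _).mpr h

/-- The curve `nodalCurve a u` with coordinates in the subring `K[u]`. -/
theorem exists_adjoin_nodalCurve (a : Fin 4 → K) (u : E) :
    ∃ A : Fin 4 → Algebra.adjoin K {u}, ∀ i, algebraMap _ E (A i) = nodalCurve a u i := by
  refine ⟨tangentResidual (fun j => algebraMap K _ (a j)) 1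
    ⟨u, Algebra.subset_adjoin (Set.mem_singleton u)⟩, fun i => ?_⟩
  rw [map_tangentResidual, map_one]
  rfl

/-- The results on `tangentResidual` apply to the second tangent line over the ring `K[u]`. -/
theorem exists_adjoin_coeff (h2 : (2 : K) ≠ 0) (h3 : (3 : K) ≠ 0) (hsum : ∑ i, a i = 0)
    (ha : ∀ i, a i ≠ 0) (hu : Transcendental K u) :
    ∃ A : Fin 4 → Algebra.adjoin K {u},
      (∀ i, algebraMap _ E (A i) = algebraMap K E (a i) * nodalCurve a u i ^ 3) ∧
      (∀ i, A i ≠ 0) ∧ ∑ i, A i = 0 := by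
  obtain ⟨q, hq⟩ := exists_adjoin_nodalCurve a u
  have hA : ∀ i, algebraMap _ E (algebraMap K (Algebra.adjoin K {u}) (a i) * q i ^ 3) =
      algebraMap K E (a i) * nodalCurve a u i ^ 3 := by
    intro i
    rw [map_mul, map_pow, hq, ← IsScalarTower.algebraMap_apply]
  refine ⟨fun i => algebraMap K _ (a i) * q i ^ 3, hA, fun i h => ?_, ?_⟩
  · have := hA i
    rw [show algebraMap K (Algebra.adjoin K {u}) (a i) * q i ^ 3 = 0 from h, map_zero] at this
    have := mul_eq_zero.mp this.symm
    simp [ha, nodalCurve_ne_zero h2 h3 hsum ha hu] at this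
  · refine FaithfulSMul.algebraMap_injective (Algebra.adjoin K {u}) E ?_
    rw [map_sum, map_zero, ← sum_mul_nodalCurve_cube u hsum]
    exact Finset.sum_congr rfl fun i _ => hA i

theorem tangentSurface_ne_zero (h2 : (2 : K) ≠ 0) (h3 : (3 : K) ≠ 0) (hsum : ∑ i, a i = 0)
    (ha : ∀ i, a i ≠ 0) (hu : Transcendental K u) (ht : Transcendental (Algebra.adjoin K {u}) t)
    (i : Fin 4) : tangentSurface a u t i ≠ 0 := by
  obtain ⟨A, hAe, hA0, hAs⟩ := exists_adjoin_coeff h2 h3 hsum ha hu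
  refine mul_ne_zero (nodalCurve_ne_zero h2 h3 hsum ha hu i) ?_
  simp only [← hAe]
  exact tangentResidual_ne_zero (Algebra.ofNat_ne_zero K _ h2) (Algebra.ofNat_ne_zero K _ h3)
    hAs hA0 ht i

/-- The parameter `t` as a rational function of `u` and the ratios of the coordinates of `s`. -/
theorem tangentSurface_param (h2 : (2 : K) ≠ 0) (h3 : (3 : K) ≠ 0) (hsum : ∑ i, a i = 0)
    (ha : ∀ i, a i ≠ 0) (hu : Transcendental K u) (ht : Transcendental (Algebra.adjoin K {u}) t) :
    t = (tangentSurface a u t 1 / tangentSurface a u t 3 / nodalCurve a u 1 -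
          (nodalCurve a u 3)⁻¹) /
        (tangentSurface a u t 0 / tangentSurface a u t 3 / nodalCurve a u 0 -
          (nodalCurve a u 3)⁻¹) := by
  obtain ⟨A, hAe, hA0, -⟩ := exists_adjoin_coeff h2 h3 hsum ha hu
  have hq := nodalCurve_ne_zero h2 h3 hsum ha hu
  have hs3 := tangentSurface_ne_zero h2 h3 hsum ha hu ht 3
  have h03 := tangentResidual_zero_ne_three (Algebra.ofNat_ne_zero K _ h2)
    (Algebra.ofNat_ne_zero K _ h3) hA0 ht
  simp only [hAe] at h03
  have hsub := tangentResidual_sub_three_mul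
    (fun j => algebraMap K E (a j) * nodalCurve a u j ^ 3) 1 t
  have h3s : (nodalCurve a u 3)⁻¹ =
      tangentResidual (fun j => algebraMap K E (a j) * nodalCurve a u j ^ 3) 1 t 3 /
        tangentSurface a u t 3 := by
    rw [eq_div_iff hs3, tangentSurface, inv_mul_cancel_left₀ (hq 3)]
  have his : ∀ i, tangentSurface a u t i / tangentSurface a u t 3 / nodalCurve a u i =
      tangentResidual (fun j => algebraMap K E (a j) * nodalCurve a u j ^ 3) 1 t i /
        tangentSurface a u t 3 := by
    intro i
    rw [div_right_comm]
    congr 1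
    rw [tangentSurface, mul_div_cancel_left₀ _ (hq i)]
  rw [his, his, h3s, ← sub_div, ← sub_div, div_div_div_cancel_right₀ hs3,
    eq_div_iff (sub_ne_zero.mpr h03)]
  linear_combination -hsub

/-- The coordinates of `s` satisfy no linear relation over `K`: such a relation would have
coefficients proportional to `aᵢ qᵢ²`, or all `(aᵢ qᵢ³)²` would be equal, and the ratios `qᵢ / q₃`
would be algebraic over `K`. -/
theorem tangentSurface_linearIndependent (h2 : (2 : K) ≠ 0) (h3 : (3 : K) ≠ 0)
    (hsum : ∑ i, a i = 0) (ha : ∀ i, a i ≠ 0) (hu : Transcendental K u)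
    (ht : Transcendental (Algebra.adjoin K {u}) t) :
    LinearIndependent K (tangentSurface a u t) := by
  rw [Fintype.linearIndependent_iff]
  intro c hc
  obtain ⟨A, hAe, hA0, hAs⟩ := exists_adjoin_coeff h2 h3 hsum ha hu
  obtain ⟨q, hqe⟩ := exists_adjoin_nodalCurve a u
  have hq := nodalCurve_ne_zero h2 h3 hsum ha hu
  have ha' : ∀ i, algebraMap K E (a i) ≠ 0 := fun i => (map_ne_zero _).mpr (ha i)
  have hrel := tangentResidual_relation (Algebra.ofNat_ne_zero K _ h2)
    (Algebra.ofNat_ne_zero K _ h3) hAs hA0 ht (w := fun i => algebraMap K _ (c i) * q i) (by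
      rw [← hc]
      refine Finset.sum_congr rfl fun i _ => ?_
      simp only [map_mul, hqe, hAe, ← IsScalarTower.algebraMap_apply]
      rw [tangentSurface, Algebra.smul_def, mul_assoc])
  have hinj := FaithfulSMul.algebraMap_injective (Algebra.adjoin K {u}) E
  have hconst := not_forall_isAlgebraic_nodalCurve_div h2 h3 hsum ha hu
  rcases hrel with h | h
  · have key : ∀ i j, algebraMap K E (c i) * algebraMap K E (a j) * nodalCurve a u j ^ 2 =
        algebraMap K E (c j) * algebraMap K E (a i) * nodalCurve a u i ^ 2 := by
      intro i j
      have hij := congrArg (algebraMap _ E) (h i j)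
      simp only [map_mul, hqe, hAe, ← IsScalarTower.algebraMap_apply] at hij
      refine mul_left_cancel₀ (mul_ne_zero (hq i) (hq j)) ?_
      linear_combination hij
    by_contra! hne
    obtain ⟨k, hk⟩ := hne
    have hc0 : ∀ j, algebraMap K E (c j) ≠ 0 := by
      intro j hj
      have := key k j
      simp [hj, hk, ha, hq] at this
    refine hconst fun i => IsAlgebraic.of_pow (n := 2) two_pos ?_
    have hi : (nodalCurve a u i / nodalCurve a u 3) ^ 2 =
        algebraMap K E (c i * a 3 / (c 3 * a i)) := by
      rw [div_pow, map_div₀, map_mul, map_mul, div_eq_div_iff (pow_ne_zero 2 (hq 3))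
        (mul_ne_zero (hc0 3) (ha' i))]
      linear_combination -(key i 3)
    rw [hi]
    exact isAlgebraic_algebraMap _
  · refine absurd (fun i => IsAlgebraic.of_pow (n := 6) (by norm_num) ?_) hconst
    have hi : (nodalCurve a u i / nodalCurve a u 3) ^ 6 = algebraMap K E (a 3 ^ 2 / a i ^ 2) := by
      have hij := congrArg (algebraMap _ E) (h i 3)
      simp only [map_pow, hAe] at hij
      rw [div_pow, map_div₀, map_pow, map_pow, div_eq_div_iff (pow_ne_zero 6 (hq 3))
        (pow_ne_zero 2 (ha' i))]
      linear_combination hij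
    rw [hi]
    exact isAlgebraic_algebraMap _

end Parametrization

/-! ### The algebraic equation for the parameter of the curve -/

section Degree

theorem natDegree_tangentResidual_le {R : Type*} [CommRing R] (a : Fin 4 → R) (i : Fin 4) :
    (tangentResidual (fun j => Polynomial.C (a j)) 1 Polynomial.X i).natDegree ≤ 3 := by
  have h : ∀ j,
      (tangentDirection (fun j => Polynomial.C (a j)) 1 Polynomial.X j).natDegree ≤ 1 := by
    intro j
    fin_cases j <;> simp only [tangentDirection] <;> simp <;> compute_degree
  have hpow : ∀ n j, (Polynomial.C (a j) *
      tangentDirection (fun j => Polynomial.C (a j)) 1 Polynomial.X j ^ n).natDegree ≤ n := by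
    intro n j
    refine (Polynomial.natDegree_C_mul_le _ _).trans (Polynomial.natDegree_pow_le.trans ?_)
    simpa using Nat.mul_le_mul_left n (h j)
  refine (Polynomial.natDegree_sub_le_of_le (n := 3)
    (Polynomial.natDegree_sum_le_of_forall_le _ _ fun j _ => hpow 3 j)
    (Polynomial.natDegree_mul_le_of_le (m := 2) (n := 1) ?_ (h i))).trans (by norm_num)
  rw [← Polynomial.C_ofNat]
  exact (Polynomial.natDegree_C_mul_le _ _).trans
    (Polynomial.natDegree_sum_le_of_forall_le _ _ fun j _ => hpow 2 j)

variable {K E : Type*} [Field K] [Field E] [Algebra K E] {a : Fin 4 → K} {u t : E}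

theorem exists_polynomial_nodalCurve (a : Fin 4 → K) (u : E) : ∃ T : Fin 4 → Polynomial K,
    (∀ i, Polynomial.aeval u (T i) = nodalCurve a u i) ∧ ∀ i, (T i).natDegree ≤ 3 := by
  refine ⟨_, fun i => ?_, natDegree_tangentResidual_le a⟩
  have := map_tangentResidual (Polynomial.aeval u : Polynomial K →ₐ[K] E).toRingHom
    (fun j => Polynomial.C (a j)) 1 Polynomial.X i
  simpa [nodalCurve] using this

/-- A relation `∑ Pᵢ(u) sᵢ = 0` between elements linearly independent over `K`, with polynomials
`Pᵢ` over `K` that are not all zero, is a nontrivial algebraic equation for `u` over every field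
containing the ratios of the `sᵢ`. -/
theorem LinearIndependent.exists_polynomial_aeval_eq_zero {ι : Type*} [Fintype ι] {s : ι → E}
    (hs : LinearIndependent K s) {k : ι} (L : IntermediateField K E) (hL : ∀ i, s i / s k ∈ L)
    {P : ι → Polynomial K} (hP : P k ≠ 0) {d : ℕ} (hd : ∀ i, (P i).natDegree ≤ d)
    (h : ∑ i, Polynomial.aeval u (P i) * s i = 0) :
    ∃ H : Polynomial L, H ≠ 0 ∧ H.natDegree ≤ d ∧ Polynomial.aeval u H = 0 := by
  have hsk : s k ≠ 0 := hs.ne_zero k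
  obtain ⟨r, hr⟩ : ∃ r : ι → L, ∀ i, algebraMap L E (r i) = s i / s k :=
    ⟨fun i => ⟨_, hL i⟩, fun i => rfl⟩
  refine ⟨∑ i, Polynomial.C (r i) * (P i).map (algebraMap K L), fun h0 => ?_, ?_, ?_⟩
  · refine hP (Polynomial.ext fun n => ?_)
    refine Fintype.linearIndependent_iff.mp hs (fun i => (P i).coeff n) ?_ k
    have h1 := congrArg (fun Q => algebraMap L E (Polynomial.coeff Q n)) h0
    simp only [Polynomial.finsetSum_coeff, Polynomial.coeff_C_mul, Polynomial.coeff_map,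
      map_sum, map_mul, Polynomial.coeff_zero, map_zero, ← IsScalarTower.algebraMap_apply, hr]
      at h1
    rw [← mul_zero (s k), ← h1, Finset.mul_sum]
    refine Finset.sum_congr rfl fun i _ => ?_
    rw [Algebra.smul_def, ← mul_assoc, mul_div_cancel₀ _ hsk, mul_comm]
  · refine Polynomial.natDegree_sum_le_of_forall_le _ _ fun i _ => ?_
    exact (Polynomial.natDegree_C_mul_le _ _).trans (Polynomial.natDegree_map_le.trans (hd i))
  · rw [map_sum, ← mul_zero (s k)⁻¹, ← h, Finset.mul_sum]
    refine Finset.sum_congr rfl fun i _ => ?_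
    rw [map_mul, Polynomial.aeval_C, Polynomial.aeval_map_algebraMap, hr]
    ring

/-- Over a field containing the ratios of the coordinates of `s`, the parameter `u` is a root of
`∑ aᵢ qᵢ(x)² sᵢ`. This polynomial does not vanish since the `sᵢ` are linearly independent
over `K`. -/
theorem exists_polynomial_tangentSurface (h2 : (2 : K) ≠ 0) (h3 : (3 : K) ≠ 0)
    (hsum : ∑ i, a i = 0) (ha : ∀ i, a i ≠ 0) (hu : Transcendental K u)
    (ht : Transcendental (Algebra.adjoin K {u}) t) (L : IntermediateField K E)
    (hL : ∀ i, tangentSurface a u t i / tangentSurface a u t 3 ∈ L) :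
    ∃ H : Polynomial L, H ≠ 0 ∧ H.natDegree ≤ 6 ∧ Polynomial.aeval u H = 0 := by
  obtain ⟨T, hTu, hTdeg⟩ := exists_polynomial_nodalCurve a u
  refine (tangentSurface_linearIndependent h2 h3 hsum ha hu ht).exists_polynomial_aeval_eq_zero L hL
    (P := fun i => Polynomial.C (a i) * T i ^ 2) (mul_ne_zero (Polynomial.C_ne_zero.mpr (ha 3)) ?_)
    (fun i => ?_) ?_
  · intro hT
    have := hTu 3
    rw [pow_eq_zero_iff two_ne_zero |>.mp hT, map_zero] at this
    exact nodalCurve_ne_zero h2 h3 hsum ha hu 3 this.symm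
  · refine (Polynomial.natDegree_C_mul_le _ _).trans (Polynomial.natDegree_pow_le.trans ?_)
    have := hTdeg i
    omega
  · rw [← sum_mul_nodalCurve_sq_mul_tangentSurface u t hsum]
    simp only [map_mul, map_pow, hTu, Polynomial.aeval_C]

theorem nodalCurve_mem (M : Subfield E) (hK : ∀ x, algebraMap K E x ∈ M) (hu : u ∈ M)
    (i : Fin 4) : nodalCurve a u i ∈ M := by
  have h := map_tangentResidual M.subtype (fun j => ⟨algebraMap K E (a j), hK _⟩) 1 ⟨u, hu⟩ i
  rw [map_one] at h
  change _ = nodalCurve a u i at h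
  exact h ▸ SetLike.coe_mem _

theorem tangentSurface_mem (M : Subfield E) (hK : ∀ x, algebraMap K E x ∈ M) (hu : u ∈ M)
    (ht : t ∈ M) (i : Fin 4) : tangentSurface a u t i ∈ M := by
  have hq := nodalCurve_mem (a := a) M hK hu
  have h := map_tangentResidual M.subtype
    (fun j => ⟨algebraMap K E (a j) * nodalCurve a u j ^ 3, mul_mem (hK _) (pow_mem (hq j) 3)⟩)
    1 ⟨t, ht⟩ i
  rw [map_one] at h
  refine mul_mem (hq i) ?_
  change _ = tangentResidual (fun j => algebraMap K E (a j) * nodalCurve a u j ^ 3) 1 t i at h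
  exact h ▸ SetLike.coe_mem _

/-- A field containing the ratios of the coordinates of `s` and the parameter `u` contains `t`. -/
theorem tangentSurface_param_mem (h2 : (2 : K) ≠ 0) (h3 : (3 : K) ≠ 0)
    (hsum : ∑ i, a i = 0) (ha : ∀ i, a i ≠ 0) (hu : Transcendental K u)
    (ht : Transcendental (Algebra.adjoin K {u}) t) (M : Subfield E)
    (hK : ∀ x, algebraMap K E x ∈ M) (huM : u ∈ M)
    (hM : ∀ i, tangentSurface a u t i / tangentSurface a u t 3 ∈ M) : t ∈ M := by
  have hq := nodalCurve_mem (a := a) M hK huM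
  rw [tangentSurface_param h2 h3 hsum ha hu ht]
  exact div_mem (sub_mem (div_mem (hM 1) (hq 1)) (inv_mem (hq 3)))
    (sub_mem (div_mem (hM 0) (hq 0)) (inv_mem (hq 3)))

end Degree

/-! ### The fraction field of the coordinate ring of the plane -/

section FunctionField

variable {K : Type*} [Field K]

local notation "𝔼" => FractionRing (MvPolynomial (Fin 3) K)

/-- The coordinate `yᵢ` of `ℙ²` as an element of the fraction field of `K[y₀, y₁, y₂]`. -/
noncomputable def planeCoord (K : Type*) [Field K] (i : Fin 3) :
    FractionRing (MvPolynomial (Fin 3) K) :=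
  algebraMap (MvPolynomial (Fin 3) K) _ (X i)

theorem planeCoord_ne_zero (i : Fin 3) : planeCoord K i ≠ 0 := by
  rw [planeCoord, Ne, FaithfulSMul.algebraMap_eq_zero_iff]
  exact X_ne_zero i

theorem algebraMap_eq_aeval_planeCoord (G : MvPolynomial (Fin 3) K) :
    algebraMap _ 𝔼 G = aeval (planeCoord K) G := by
  have : IsScalarTower.toAlgHom K (MvPolynomial (Fin 3) K) 𝔼 = aeval (planeCoord K) := by
    ext i
    simp [planeCoord]
  exact congrArg (fun f => f G) this

/-- Three elements over which the coordinates `y₀, y₁, y₂` are algebraic are algebraically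
independent, since the transcendence degree is three. -/
theorem algebraicIndependent_of_isAlgebraic_planeCoord {v : Fin 3 → 𝔼}
    (h : ∀ i, IsAlgebraic (IntermediateField.adjoin K (Set.range v)) (planeCoord K i)) :
    AlgebraicIndependent K v := by
  have htop : ∀ e : 𝔼, e ∈ algebraicClosure (IntermediateField.adjoin K (Set.range v)) 𝔼 := by
    intro e
    have hpoly : ∀ G : MvPolynomial (Fin 3) K, algebraMap _ 𝔼 G ∈
        algebraicClosure (IntermediateField.adjoin K (Set.range v)) 𝔼 := by
      intro G
      induction G using MvPolynomial.induction_on with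
      | C r =>
        rw [← MvPolynomial.algebraMap_eq, ← IsScalarTower.algebraMap_apply,
          IsScalarTower.algebraMap_apply K (IntermediateField.adjoin K (Set.range v))]
        exact IntermediateField.algebraMap_mem _ _
      | add p q hp hq => rw [map_add]; exact add_mem hp hq
      | mul_X p i hp => rw [map_mul]; exact mul_mem hp (mem_algebraicClosure_iff.mpr (h i))
    obtain ⟨x, y, -, rfl⟩ := IsFractionRing.div_surjective (A := MvPolynomial (Fin 3) K) e
    exact div_mem (hpoly x) (hpoly y)
  have h1 : Algebra.IsAlgebraic (IntermediateField.adjoin K (Set.range v)) 𝔼 :=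
    ⟨fun e => mem_algebraicClosure_iff.mp (htop e)⟩
  open scoped IntermediateField.algebraAdjoinAdjoin in
  have h2 : Algebra.IsAlgebraic (Algebra.adjoin K (Set.range v)) 𝔼 :=
    (IsFractionRing.comap_isAlgebraic_iff (A := Algebra.adjoin K (Set.range v))
      (K := IntermediateField.adjoin K (Set.range v))).mpr h1
  have hy : AlgebraicIndependent K (planeCoord K) := fun p q hpq => by
    rw [← algebraMap_eq_aeval_planeCoord, ← algebraMap_eq_aeval_planeCoord] at hpq
    exact IsFractionRing.injective (MvPolynomial (Fin 3) K) 𝔼 hpq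
  exact (Algebra.IsAlgebraic.isTranscendenceBasis_of_lift_le_trdeg_of_finite K v
    hy.lift_cardinalMk_le_trdeg).1

/-- A form of degree `d` is `y₀ᵈ` times its dehomogenization. -/
theorem algebraMap_eq_pow_mul_of_isHomogeneous {G : MvPolynomial (Fin 3) K} {d : ℕ}
    (hG : G.IsHomogeneous d) : algebraMap _ 𝔼 G = planeCoord K 0 ^ d *
      aeval (fun i => planeCoord K i / planeCoord K 0) G := by
  rw [algebraMap_eq_aeval_planeCoord, aeval_def, aeval_def, eval₂_eq', eval₂_eq', Finset.mul_sum]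
  refine Finset.sum_congr rfl fun m hm => ?_
  have hmd : ∑ i, m i = d := by
    rw [← hG (mem_support_iff.mp hm), Finsupp.weight_apply, Finsupp.sum_fintype] <;> simp
  simp only [div_pow, Finset.prod_div_distrib, Finset.prod_pow_eq_pow_sum, hmd]
  have := pow_ne_zero d (planeCoord_ne_zero (K := K) 0)
  field_simp

variable (K) in
/-- The affine coordinates `u = y₁ / y₀` and `t = y₂ / y₀` of the plane satisfy the genericity
conditions of the parametrization. -/
theorem transcendental_affineCoord :
    Transcendental K (planeCoord K 1 / planeCoord K 0) ∧
      Transcendental (Algebra.adjoin K {planeCoord K 1 / planeCoord K 0})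
        (planeCoord K 2 / planeCoord K 0) := by
  have hy := planeCoord_ne_zero (K := K) 0
  have hv : AlgebraicIndependent K
      ![planeCoord K 0, planeCoord K 1 / planeCoord K 0, planeCoord K 2 / planeCoord K 0] := by
    refine algebraicIndependent_of_isAlgebraic_planeCoord fun i => ?_
    set v := ![planeCoord K 0, planeCoord K 1 / planeCoord K 0, planeCoord K 2 / planeCoord K 0]
    have hm : ∀ j, v j ∈ IntermediateField.adjoin K (Set.range v) := fun j =>
      IntermediateField.subset_adjoin _ _ (Set.mem_range_self j)
    have hi : planeCoord K i ∈ IntermediateField.adjoin K (Set.range v) := by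
      fin_cases i
      · exact hm 0
      · exact (div_mul_cancel₀ (planeCoord K 1) hy) ▸ mul_mem (hm 1) (hm 0)
      · exact (div_mul_cancel₀ (planeCoord K 2) hy) ▸ mul_mem (hm 2) (hm 0)
    exact isAlgebraic_algebraMap (⟨_, hi⟩ : IntermediateField.adjoin K (Set.range v))
  refine ⟨hv.transcendental 1, ?_⟩
  have h := hv.transcendental_adjoin (s := {1}) (i := 2) (by simp)
  rwa [Set.image_singleton] at h

end FunctionField

/-! ### The parametrization by forms -/

section Forms

variable {K : Type*} [Field K]

/-- The coefficients of `diagonalCubic a` as a diagonal form in four variables; their sum is `0`. -/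
def surfaceCoeff (a : Fin 3 → K) : Fin 4 → K := ![a 0, a 1, a 2, -(a 0 + a 1 + a 2)]

theorem sum_surfaceCoeff (a : Fin 3 → K) : ∑ i, surfaceCoeff a i = 0 := by
  simp [surfaceCoeff, Fin.sum_univ_four]

theorem diagonalCubic_eq (a : Fin 3 → K) :
    diagonalCubic a = ∑ i, C (surfaceCoeff a i) * X i ^ 3 := by
  simp only [diagonalCubic, surfaceCoeff, Fin.sum_univ_four, Matrix.cons_val, C_neg, C_add]
  ring

/-- The `i`-th coordinate point is singular if the `i`-th coefficient vanishes. -/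
theorem surfaceCoeff_ne_zero {a : Fin 3 → K}
    (hS : IsSmoothHypersurface (n := 3) (diagonalCubic a)) (i : Fin 4) : surfaceCoeff a i ≠ 0 := by
  intro hi
  obtain ⟨j, hj⟩ := hS (Pi.single i 1) (by simp) (by
    rw [diagonalCubic_eq, map_sum]
    refine Finset.sum_eq_zero fun k _ => ?_
    by_cases hk : k = i
    · subst hk; simp [hi]
    · simp [hk])
  refine hj ?_
  rw [diagonalCubic_eq, map_sum, map_sum]
  refine Finset.sum_eq_zero fun k _ => ?_
  by_cases hk : k = i
  · subst hk; simp [hi]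
  · simp only [Derivation.leibniz, Derivation.leibniz_pow, pderiv_C, pderiv_X]
    simp [hk]

theorem isHomogeneous_tangentResidual {σ : Type*} {A : Fin 4 → MvPolynomial σ K}
    {x y : MvPolynomial σ K} {m : ℕ} (hA : ∀ i, (A i).IsHomogeneous m) (hx : x.IsHomogeneous 1)
    (hy : y.IsHomogeneous 1) (i : Fin 4) : (tangentResidual A x y i).IsHomogeneous (4 * m + 3) := by
  have he : ∀ j, (tangentDirection A x y j).IsHomogeneous (m + 1) := by
    intro j
    fin_cases j
    · exact (hA 2).mul hx
    · exact (hA 2).mul hy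
    · exact (((hA 0).mul hx).add ((hA 1).mul hy)).neg
    · exact isHomogeneous_zero _ _ _
  have hs : ∀ n, (∑ j, A j * tangentDirection A x y j ^ n).IsHomogeneous (m + (m + 1) * n) :=
    fun n => IsHomogeneous.sum _ _ _ fun j _ => (hA j).mul ((he j).pow n)
  have h3 : (3 : MvPolynomial σ K).IsHomogeneous 0 := isHomogeneous_C σ (3 : K)
  refine IsHomogeneous.sub ?_ ?_
  · rw [show 4 * m + 3 = m + (m + 1) * 3 by ring]
    exact hs 3
  · rw [show 4 * m + 3 = 0 + (m + (m + 1) * 2) + (m + 1) by ring]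
    exact (h3.mul (hs 2)).mul (he i)

/-- The form of degree three in `y₀, y₁` that `nodalCurve a (y₁ / y₀)` dehomogenizes. -/
noncomputable def nodalCurveForm (a : Fin 4 → K) : Fin 4 → MvPolynomial (Fin 3) K :=
  tangentResidual (fun j => C (a j)) (X 0) (X 1)

/-- The form of degree 42 in `y₀, y₁, y₂` that `tangentSurface a (y₁ / y₀) (y₂ / y₀)`
dehomogenizes. -/
noncomputable def tangentSurfaceForm (a : Fin 4 → K) (i : Fin 4) : MvPolynomial (Fin 3) K :=
  nodalCurveForm a i * tangentResidual (fun j => C (a j) * nodalCurveForm a j ^ 3) (X 0) (X 2) i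

theorem isHomogeneous_nodalCurveForm (a : Fin 4 → K) (i : Fin 4) :
    (nodalCurveForm a i).IsHomogeneous 3 :=
  isHomogeneous_tangentResidual (m := 0) (fun _ => isHomogeneous_C _ _) (isHomogeneous_X _ _)
    (isHomogeneous_X _ _) i

theorem isHomogeneous_tangentSurfaceForm (a : Fin 4 → K) (i : Fin 4) :
    (tangentSurfaceForm a i).IsHomogeneous 42 :=
  (isHomogeneous_nodalCurveForm a i).mul (isHomogeneous_tangentResidual (m := 9)
    (fun j => by
      simpa using (isHomogeneous_C _ (a j)).mul ((isHomogeneous_nodalCurveForm a j).pow 3))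
    (isHomogeneous_X _ _) (isHomogeneous_X _ _) i)

theorem aeval_nodalCurveForm {E : Type*} [Field E] [Algebra K E] (a : Fin 4 → K) {v : Fin 3 → E}
    (hv : v 0 = 1) (i : Fin 4) : aeval v (nodalCurveForm a i) = nodalCurve a (v 1) i := by
  have h := map_tangentResidual (aeval v : MvPolynomial (Fin 3) K →ₐ[K] E).toRingHom
    (fun j => C (a j)) (X 0) (X 1) i
  simp only [AlgHom.toRingHom_eq_coe, RingHom.coe_coe, aeval_C, aeval_X, hv] at h
  exact h

theorem aeval_tangentSurfaceForm {E : Type*} [Field E] [Algebra K E] (a : Fin 4 → K)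
    {v : Fin 3 → E} (hv : v 0 = 1) (i : Fin 4) :
    aeval v (tangentSurfaceForm a i) = tangentSurface a (v 1) (v 2) i := by
  have h := map_tangentResidual (aeval v : MvPolynomial (Fin 3) K →ₐ[K] E).toRingHom
    (fun j => C (a j) * nodalCurveForm a j ^ 3) (X 0) (X 2) i
  simp only [AlgHom.toRingHom_eq_coe, RingHom.coe_coe, map_mul, map_pow, aeval_C, aeval_X, hv,
    aeval_nodalCurveForm a hv] at h
  rw [tangentSurfaceForm, map_mul, h, aeval_nodalCurveForm a hv, tangentSurface]

/-- The surface point over the generic point of the plane, in homogeneous and affine form. -/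
theorem algebraMap_tangentSurfaceForm (a : Fin 4 → K) (i : Fin 4) :
    algebraMap _ (FractionRing (MvPolynomial (Fin 3) K)) (tangentSurfaceForm a i) =
      planeCoord K 0 ^ 42 * tangentSurface a (planeCoord K 1 / planeCoord K 0)
        (planeCoord K 2 / planeCoord K 0) i := by
  rw [algebraMap_eq_pow_mul_of_isHomogeneous (isHomogeneous_tangentSurfaceForm a i),
    aeval_tangentSurfaceForm a (div_self (planeCoord_ne_zero 0))]

theorem tangentSurfaceForm_ne_zero {a : Fin 4 → K} (h2 : (2 : K) ≠ 0) (h3 : (3 : K) ≠ 0)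
    (hsum : ∑ i, a i = 0) (ha : ∀ i, a i ≠ 0) (i : Fin 4) : tangentSurfaceForm a i ≠ 0 := by
  intro h
  have h' := algebraMap_tangentSurfaceForm a i
  obtain ⟨hu, ht⟩ := transcendental_affineCoord K
  rw [h, map_zero, eq_comm, mul_eq_zero] at h'
  exact h'.elim (pow_ne_zero _ (planeCoord_ne_zero 0))
    (tangentSurface_ne_zero h2 h3 hsum ha hu ht i)

end Forms

/-! ### Dominance and degree -/

section Dominance

variable {K : Type*} [Field K] {a : Fin 4 → K}

/-- Three of the four forms are algebraically independent: the field generated by them determines,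
up to finitely many values, the fourth by the equation of the surface, then `u` and `t`, and
finally `y₀`. -/
theorem algebraicIndependent_tangentSurfaceForm (h2 : (2 : K) ≠ 0) (h3 : (3 : K) ≠ 0)
    (hsum : ∑ i, a i = 0) (ha : ∀ i, a i ≠ 0) :
    AlgebraicIndependent K fun i : Fin 3 =>
      algebraMap _ (FractionRing (MvPolynomial (Fin 3) K)) (tangentSurfaceForm a i.succ) := by
  obtain ⟨hu, ht⟩ := transcendental_affineCoord K
  simp only [algebraMap_tangentSurfaceForm]
  have hs0 := tangentSurface_ne_zero h2 h3 hsum ha hu ht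
  have hrel := sum_mul_tangentSurface_cube (planeCoord K 1 / planeCoord K 0)
    (planeCoord K 2 / planeCoord K 0) hsum
  have hpoly := exists_polynomial_tangentSurface h2 h3 hsum ha hu ht
  have hmemσ := tangentSurface_mem (a := a) (u := planeCoord K 1 / planeCoord K 0)
    (t := planeCoord K 2 / planeCoord K 0)
  have hmem := tangentSurface_param_mem h2 h3 hsum ha hu ht
  have hy0 := planeCoord_ne_zero (K := K) 0
  have hy1 : planeCoord K 1 = planeCoord K 1 / planeCoord K 0 * planeCoord K 0 := by
    rw [div_mul_cancel₀ _ hy0]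
  have hy2 : planeCoord K 2 = planeCoord K 2 / planeCoord K 0 * planeCoord K 0 := by
    rw [div_mul_cancel₀ _ hy0]
  generalize planeCoord K 1 / planeCoord K 0 = u at *
  generalize planeCoord K 2 / planeCoord K 0 = t at *
  refine algebraicIndependent_of_isAlgebraic_planeCoord ?_
  generalize tangentSurface a u t = σ at *
  generalize hF : IntermediateField.adjoin K
    (Set.range fun i : Fin 3 => planeCoord K 0 ^ 42 * σ i.succ) = F
  have hsucc : ∀ i : Fin 3, planeCoord K 0 ^ 42 * σ i.succ ∈ F := fun i =>
    hF ▸ IntermediateField.subset_adjoin _ _ (Set.mem_range_self i)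
  set Ω := algebraicClosure F (FractionRing (MvPolynomial (Fin 3) K))
  have hFΩ : ∀ x ∈ F, x ∈ Ω := fun x hx => Ω.algebraMap_mem (⟨x, hx⟩ : F)
  have hKF : ∀ x, algebraMap K (FractionRing (MvPolynomial (Fin 3) K)) x ∈ F := F.algebraMap_mem
  -- the cube of the fourth form is given by the equation of the surface
  have h0 : planeCoord K 0 ^ 42 * σ 0 ∈ Ω := by
    refine mem_algebraicClosure_iff.mpr (IsAlgebraic.of_pow (n := 3) (by norm_num) ?_)
    have hc : (planeCoord K 0 ^ 42 * σ 0) ^ 3 = -(algebraMap K _ (a 0))⁻¹ *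
        ∑ i : Fin 3, algebraMap K _ (a i.succ) * (planeCoord K 0 ^ 42 * σ i.succ) ^ 3 := by
      have ha0 : algebraMap K (FractionRing (MvPolynomial (Fin 3) K)) (a 0) ≠ 0 :=
        (map_ne_zero _).mpr (ha 0)
      simp only [Fin.sum_univ_succ, Algebra.smul_def] at hrel ⊢
      field_simp
      linear_combination (planeCoord K 0 ^ 42) ^ 3 * hrel
    have hcF : (planeCoord K 0 ^ 42 * σ 0) ^ 3 ∈ F := by
      rw [hc]
      exact mul_mem (neg_mem (inv_mem (hKF _)))
        (sum_mem fun i _ => mul_mem (hKF _) (pow_mem (hsucc i) 3))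
    exact isAlgebraic_algebraMap (⟨_, hcF⟩ : F)
  have hall : ∀ i, planeCoord K 0 ^ 42 * σ i ∈ Ω := fun i =>
    Fin.cases h0 (fun j => hFΩ _ (hsucc j)) i
  have hratio : ∀ i, σ i / σ 3 ∈ Ω := by
    intro i
    rw [← mul_div_mul_left _ _ (pow_ne_zero 42 hy0)]
    exact div_mem (hall i) (hall 3)
  have huΩ : u ∈ Ω := by
    obtain ⟨H, hH0, -, hHu⟩ := hpoly (Ω.restrictScalars K) hratio
    have hu' : IsAlgebraic Ω u := ⟨H, hH0, hHu⟩
    have : Algebra.IsAlgebraic F Ω := algebraicClosure.isAlgebraic F _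
    exact mem_algebraicClosure_iff.mpr (hu'.restrictScalars F)
  have hKΩ : ∀ x, algebraMap K _ x ∈ Ω.toSubfield := fun x => hFΩ _ (hKF x)
  have htΩ : t ∈ Ω := hmem Ω.toSubfield hKΩ huΩ hratio
  have hy0Ω : planeCoord K 0 ∈ Ω := by
    refine mem_algebraicClosure_iff.mpr (IsAlgebraic.of_pow (n := 42) (by norm_num) ?_)
    rw [← mul_div_cancel_right₀ (planeCoord K 0 ^ 42) (hs0 3)]
    exact mem_algebraicClosure_iff.mp (div_mem (hall 3) (hmemσ Ω.toSubfield hKΩ huΩ htΩ 3))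
  intro i
  rw [← mem_algebraicClosure_iff]
  fin_cases i
  · exact hy0Ω
  · exact hy1 ▸ mul_mem huΩ hy0Ω
  · exact hy2 ▸ mul_mem htΩ hy0Ω

theorem algebraMap_bind₁ {σ τ : Type*} (f : σ → MvPolynomial τ K) (G : MvPolynomial σ K) :
    algebraMap _ (FractionRing (MvPolynomial τ K)) (bind₁ f G) =
      aeval (fun i => algebraMap _ (FractionRing (MvPolynomial τ K)) (f i)) G :=
  comp_aeval_apply f (IsScalarTower.toAlgHom K (MvPolynomial τ K) _) G

/-- The rational map `(y₀ : y₁ : y₂) ↦ s` from the plane to the surface. -/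
noncomputable def tangentSurfaceMap (h2 : (2 : K) ≠ 0) (h3 : (3 : K) ≠ 0)
    (hsum : ∑ i, a i = 0) (ha : ∀ i, a i ≠ 0) : ProjRationalMap K 2 3 where
  coord := tangentSurfaceForm a
  formDegree := 42
  isHomogeneous := isHomogeneous_tangentSurfaceForm a
  exists_ne_zero := ⟨0, tangentSurfaceForm_ne_zero h2 h3 hsum ha 0⟩

theorem sum_smul_algebraMap_tangentSurfaceForm_cube (hsum : ∑ i, a i = 0) :
    ∑ i, a i • algebraMap _ (FractionRing (MvPolynomial (Fin 3) K)) (tangentSurfaceForm a i) ^ 3 =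
      0 := by
  rw [← mul_zero ((planeCoord K 0 ^ 42) ^ 3), ← sum_mul_tangentSurface_cube
    (planeCoord K 1 / planeCoord K 0) (planeCoord K 2 / planeCoord K 0) hsum, Finset.mul_sum]
  refine Finset.sum_congr rfl fun i _ => ?_
  rw [algebraMap_tangentSurfaceForm, mul_pow, mul_smul_comm]

theorem tangentSurfaceMap_isDominantOnto (h2 : (2 : K) ≠ 0) (h3 : (3 : K) ≠ 0)
    (hsum : ∑ i, a i = 0) (ha : ∀ i, a i ≠ 0) :
    (tangentSurfaceMap h2 h3 hsum ha).IsDominantOnto (∑ i, C (a i) * X i ^ 3) := by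
  have hinj := IsFractionRing.injective (MvPolynomial (Fin 3) K)
    (FractionRing (MvPolynomial (Fin 3) K))
  have hF := sum_smul_algebraMap_tangentSurfaceForm_cube hsum
  constructor
  · refine hinj ?_
    rw [map_zero, algebraMap_bind₁, ← hF, map_sum]
    simp [tangentSurfaceMap, Algebra.smul_def]
  · intro G d _ hG x hx
    have hG' : aeval (fun i => algebraMap (MvPolynomial (Fin 3) K)
        (FractionRing (MvPolynomial (Fin 3) K)) (tangentSurfaceForm a i)) G = 0 :=
      (algebraMap_bind₁ (tangentSurfaceForm a) G).symm.trans
        ((congrArg (algebraMap (MvPolynomial (Fin 3) K) _) hG).trans (map_zero _))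
    have hdvd : (∑ i, C (a i) * X i ^ 3) ∣ G := diagonal_dvd_of_aeval_eq_zero h3 ha
      (s := fun i => algebraMap (MvPolynomial (Fin 3) K)
        (FractionRing (MvPolynomial (Fin 3) K)) (tangentSurfaceForm a i))
      (algebraicIndependent_tangentSurfaceForm h2 h3 hsum ha) hF hG'
    have := map_dvd (aeval x) hdvd
    rwa [hx, zero_dvd_iff] at this

open IntermediateField in
theorem tangentSurfaceMap_degree_le (h2 : (2 : K) ≠ 0) (h3 : (3 : K) ≠ 0)
    (hsum : ∑ i, a i = 0) (ha : ∀ i, a i ≠ 0) : (tangentSurfaceMap h2 h3 hsum ha).degree ≤ 6 := by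
  obtain ⟨hu, ht⟩ := transcendental_affineCoord K
  set L := (tangentSurfaceMap h2 h3 hsum ha).pullbackField
  set u := planeCoord K 1 / planeCoord K 0
  set t := planeCoord K 2 / planeCoord K 0
  have hL : ∀ i, tangentSurface a u t i / tangentSurface a u t 3 ∈ L := by
    intro i
    refine ⟨1, X i, X 3, isHomogeneous_X _ _, isHomogeneous_X _ _, ?_, ?_⟩
    · rw [bind₁_X_right]
      exact tangentSurfaceForm_ne_zero h2 h3 hsum ha 3
    · have hr : tangentSurface a u t i / tangentSurface a u t 3 =
          algebraMap _ (FractionRing (MvPolynomial (Fin 3) K)) (tangentSurfaceForm a i) /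
            algebraMap _ (FractionRing (MvPolynomial (Fin 3) K)) (tangentSurfaceForm a 3) := by
        rw [algebraMap_tangentSurfaceForm, algebraMap_tangentSurfaceForm,
          mul_div_mul_left _ _ (pow_ne_zero 42 (planeCoord_ne_zero 0))]
      rw [bind₁_X_right, bind₁_X_right]
      exact hr
  obtain ⟨H, hH0, hHd, hHu⟩ := exists_polynomial_tangentSurface h2 h3 hsum ha hu ht L hL
  have huL : u ∈ L⟮u⟯ := mem_adjoin_simple_self L u
  have hLM : ∀ x ∈ L, x ∈ L⟮u⟯ := fun x hx => L⟮u⟯.algebraMap_mem ⟨x, hx⟩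
  have hKM : ∀ x, algebraMap K _ x ∈ L⟮u⟯.toSubfield := fun x => hLM _ (L.algebraMap_mem x)
  have htL : t ∈ L⟮u⟯ := tangentSurface_param_mem h2 h3 hsum ha hu ht L⟮u⟯.toSubfield hKM huL
    fun i => hLM _ (hL i)
  have hv : ∀ i, planeCoord K i / planeCoord K 0 ∈ L⟮u⟯ := by
    intro i
    fin_cases i
    · show planeCoord K 0 / planeCoord K 0 ∈ L⟮u⟯
      rw [div_self (planeCoord_ne_zero 0)]
      exact one_mem _
    · exact huL
    · exact htL
  have haff : ∀ G : MvPolynomial (Fin 3) K,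
      aeval (fun i => planeCoord K i / planeCoord K 0) G ∈ L⟮u⟯ := by
    intro G
    induction G using MvPolynomial.induction_on with
    | C r => rw [aeval_C]; exact hKM r
    | add p q hp hq => rw [map_add]; exact add_mem hp hq
    | mul_X p i hp => rw [map_mul, aeval_X]; exact mul_mem hp (hv i)
  -- the function field of the plane is generated by `u` over that of the surface
  have hle : extendScalars (tangentSurfaceMap h2 h3 hsum ha).pullbackField_le ≤ L⟮u⟯ := by
    rintro _ ⟨d, G, H, hG, hH, -, rfl⟩
    have hid : ∀ P : MvPolynomial (Fin 3) K, bind₁ (ProjRationalMap.id K 2).coord P = P :=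
      fun P => by simp [ProjRationalMap.id]
    rw [hid, hid, algebraMap_eq_pow_mul_of_isHomogeneous hG,
      algebraMap_eq_pow_mul_of_isHomogeneous hH,
      mul_div_mul_left _ _ (pow_ne_zero d (planeCoord_ne_zero 0))]
    exact div_mem (haff G) (haff H)
  have hint : IsIntegral L u := IsAlgebraic.isIntegral ⟨H, hH0, hHu⟩
  have hfin : FiniteDimensional L L⟮u⟯ := adjoin.finiteDimensional hint
  have hdeg : Module.finrank L L⟮u⟯ ≤ 6 := by
    rw [adjoin.finrank hint]
    exact (Polynomial.natDegree_le_of_dvd (minpoly.dvd L u hHu) hH0).trans hHd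
  calc (tangentSurfaceMap h2 h3 hsum ha).degree ≤ Module.rank L L⟮u⟯ :=
        LinearMap.rank_le_of_injective (inclusion hle).toLinearMap (inclusion_injective hle)
    _ = (Module.finrank L L⟮u⟯ : Cardinal) := (Module.finrank_eq_rank L L⟮u⟯).symm
    _ ≤ 6 := by exact_mod_cast hdeg

end Dominance

theorem mainTheorem3 {K : Type*} [Field K] (h2 : ringChar K ≠ 2) (h3 : ringChar K ≠ 3)
    (hω : ∃ ω : K, IsPrimitiveRoot ω 3) (a : Fin 3 → K)
    (hS : IsSmoothHypersurface (n := 3) (diagonalCubic a)) :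
    ∃ φ : ProjRationalMap K 2 3, φ.IsDominantOnto (diagonalCubic a) ∧ φ.degree ≤ 6 := by
  have h2' : (2 : K) ≠ 0 := Ring.two_ne_zero h2
  have h3' : (3 : K) ≠ 0 := fun h => h3 <|
    ((Nat.dvd_prime Nat.prime_three).mp
      (ringChar.dvd (R := K) (x := 3) (by exact_mod_cast h))).resolve_left
      CharP.ringChar_ne_one
  have hsum := sum_surfaceCoeff a
  have ha := surfaceCoeff_ne_zero hS
  refine ⟨tangentSurfaceMap h2' h3' hsum ha, ?_, tangentSurfaceMap_degree_le h2' h3' hsum ha⟩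
  rw [diagonalCubic_eq]
  exact tangentSurfaceMap_isDominantOnto h2' h3' hsum ha
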